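/- Let $\mathfrak H_1,\mathfrak H_2$ be complex Hilbert spaces, $\mathfrak H=\mathfrak H_1\oplus\mathfrak H_2$, and let $$T^\circ=\begin{pmatrix}T^\circ_{11}&T^\circ_{12}\\ T^\circ_{21}&T^\circ_{22}\end{pmatrix}$$ be a symmetric (in particular densely defined) operator matrix in $\mathfrak H$ with domain $\operatorname{dom}T^\circ_{11}\oplus\operatorname{dom}T^\circ_{22}$, where $T^\circ_{21}\colon\operatorname{dom}T^\circ_{11}\to\mathfrak H_2$ and $T^\circ_{12}\colon\operatorname{dom}T^\circ_{22}\to\mathfrak H_1$. Let $\varkappa,\tau\in\mathbb R$ be such that $\langle(T^\circ_{11}-\varkappa)y,y\rangle\ge\|y\|^2$ for $y\in\operatorname{dom}T^\circ_{11}$ and $\langle(\tau-T^\circ_{22})y,y\rangle\ge\|y\|^2$ for $y\in\operatorname{dom}T^\circ_{22}$. For a Hilbert space $\mathfrak D$, let $\mathfrak D^*$ be the space of bounded antilinear functionals on $\mathfrak D$; for a bounded $I\colon\mathfrak D\to\mathfrak H$ let $I^*\colon\mathfrak H\to\mathfrak D^*$ be given by $\langle I^*x,y\rangle=\langle x,Iy\rangle_{\mathfrak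 H}$. Let $\mathfrak D_2$ be the completion of $\operatorname{dom}T^\circ_{22}$ in the norm $\langle(\tau-T^\circ_{22})y,y\rangle^{1/2}$, $I_2\colon\mathfrak D_2\to\mathfrak H_2$ the embedding, $T_{22}\colon\mathfrak D_2\to\mathfrak D_2^*$ the bounded extension of $I_2^*T^\circ_{22}I_2$, and $T^\bullet_{22}=(I_2^*)^{-1}T_{22}I_2^{-1}$ the corresponding Friedrichs extension of $T^\circ_{22}$. Let $\mathfrak D_1$ be the completion of $\operatorname{dom}T^\circ_{11}$ in the norm $$\bigl[\langle(T^\circ_{11}-\varkappa)y,y\rangle+\langle(\tau-T^\bullet_{22})^{-1}T^\circ_{21}y,T^\circ_{21}y\rangle\bigr]^{1/2},$$ and $I_1\colon\mathfrak D_1\to\mathfrak H_1$ the embedding. Put $\mathfrak D=\mathfrak D_1\oplus\mathfrak D_2$, $I=I_1\oplus I_2\colon\mathfrak D\to\mathfrak H$; then $I$ is injective with dense range, and $I^*T^\circ I$ extends by continuity to a bounded operator $T\colon\mathfrak D\to\mathfrak D^*$. The (unbounded) operator $T^\bullet=(I^*)^{-1}TI^{-1}$ in $\mathfrak H$ is called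 the angular extension of $T^\circ$. Let $T^\natural(\lambda)=T-\lambda I^*I\colon\mathfrak D\to\mathfrak D^*$ for $\lambda\in\mathbb C$. Then a number $\lambda\in\mathbb R$ belongs to the spectrum of $T^\bullet$ if and only if $T^\natural(\lambda)$ has no bounded inverse. Moreover, the multiplicity $\dim\ker(T^\bullet-\lambda)$ of every eigenvalue $\lambda\in\mathbb R$ of $T^\bullet$ equals $\dim\ker T^\natural(\lambda)$. -/

import Mathlib

noncomputable section

open scoped InnerProductSpace

/-! ### Unbounded operators: bounded inverses, spectrum, multiplicity -/

section Unbounded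

variable {E : Type*} [NormedAddCommGroup E] [NormedSpace ℂ E]

/-- The operator `A - c`, with the same domain as `A`. -/
def pmapSub (A : E →ₗ.[ℂ] E) (c : ℂ) : E →ₗ.[ℂ] E where
  domain := A.domain
  toFun := A.toFun - c • A.domain.subtype

/-- The everywhere defined bounded operator `R` is a (two-sided) inverse of the operator `A`. -/
def IsBoundedInverse (A : E →ₗ.[ℂ] E) (R : E →L[ℂ] E) : Prop :=
  (∀ x : E, ∃ h : R x ∈ A.domain, A ⟨R x, h⟩ = x) ∧ ∀ x : A.domain, R (A x) = x

/-- The resolvent set of an (unbounded) operator. -/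
def pmapResolventSet (A : E →ₗ.[ℂ] E) : Set ℂ :=
  {c | ∃ R : E →L[ℂ] E, IsBoundedInverse (pmapSub A c) R}

/-- The spectrum of an (unbounded) operator. -/
def pmapSpectrum (A : E →ₗ.[ℂ] E) : Set ℂ := (pmapResolventSet A)ᶜ

/-- `ker (A - c)`, as a subspace of the domain of `A`. -/
def pmapEigenspace (A : E →ₗ.[ℂ] E) (c : ℂ) : Submodule ℂ A.domain :=
  LinearMap.ker (pmapSub A c).toFun

/-- `c` is an eigenvalue of `A`. -/
def IsPMapEigenvalue (A : E →ₗ.[ℂ] E) (c : ℂ) : Prop :=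
  ∃ x : A.domain, x ≠ 0 ∧ A x = c • (x : E)

/-- The multiplicity of `c` as an eigenvalue of `A`: the dimension of `ker (A - c)`. -/
def pmapMultiplicity (A : E →ₗ.[ℂ] E) (c : ℂ) : Cardinal :=
  Module.rank ℂ (pmapEigenspace A c)

open Classical in
/-- The bounded inverse of the operator `A` (zero if there is none). -/
def boundedInverse (A : E →ₗ.[ℂ] E) : E →L[ℂ] E :=
  if h : ∃ R, IsBoundedInverse A R then h.choose else 0

theorem boundedInverse_eq {A : E →ₗ.[ℂ] E} {R : E →L[ℂ] E} (hR : IsBoundedInverse A R) :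
    boundedInverse A = R := by
  have h : ∃ R, IsBoundedInverse A R := ⟨R, hR⟩
  have hb : boundedInverse A = h.choose := dif_pos h
  rw [hb]
  ext x
  obtain ⟨hx, hx'⟩ := hR.1 x
  have := h.choose_spec.2 ⟨R x, hx⟩
  rwa [hx'] at this

end Unbounded

/-- The spectrum of a family of bounded operators: the parameters at which the operator has no
bounded inverse. -/
def pencilSpectrum {D E : Type*} [NormedAddCommGroup D] [NormedSpace ℂ D]
    [NormedAddCommGroup E] [NormedSpace ℂ E] (P : ℂ → D →L[ℂ] E) : Set ℂ :=
  {c | ¬ (P c).IsInvertible}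

/-! ### Rigged spaces -/

/-- A rigging `D⁺ → B → D⁻` of a Banach space `B`: two bounded injections of Banach spaces with
dense ranges. (Completeness of the three spaces is not part of the structure; it holds in all uses
below.) -/
structure Rigging (B Dp Dm : Type*) [NormedAddCommGroup B] [NormedSpace ℂ B]
    [NormedAddCommGroup Dp] [NormedSpace ℂ Dp] [NormedAddCommGroup Dm] [NormedSpace ℂ Dm] where
  Ip : Dp →L[ℂ] B
  Im : B →L[ℂ] Dm
  injective_Ip : Function.Injective Ip
  injective_Im : Function.Injective Im
  denseRange_Ip : DenseRange Ip
  denseRange_Im : DenseRange Im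

namespace Rigging

variable {B Dp Dm : Type*} [NormedAddCommGroup B] [NormedSpace ℂ B]
  [NormedAddCommGroup Dp] [NormedSpace ℂ Dp] [NormedAddCommGroup Dm] [NormedSpace ℂ Dm]

/-- The graph of `(I⁻)⁻¹ T (I⁺)⁻¹`. -/
def bulletGraph (A : Rigging B Dp Dm) (T : Dp →L[ℂ] Dm) : Submodule ℂ (B × B) where
  carrier := {p | ∃ y : Dp, A.Ip y = p.1 ∧ T y = A.Im p.2}
  add_mem' := by
    rintro p q ⟨y, hy, hy'⟩ ⟨z, hz, hz'⟩
    exact ⟨y + z, by simp [hy, hz], by simp [hy', hz']⟩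
  zero_mem' := ⟨0, by simp, by simp⟩
  smul_mem' := by
    rintro c p ⟨y, hy, hy'⟩
    exact ⟨c • y, by simp [hy], by simp [hy']⟩

/-- The unbounded operator `T^• = (I⁻)⁻¹ T (I⁺)⁻¹` in `B` of a bounded operator `T : D⁺ → D⁻`. -/
def bullet (A : Rigging B Dp Dm) (T : Dp →L[ℂ] Dm) : B →ₗ.[ℂ] B :=
  (A.bulletGraph T).toLinearPMap

theorem bullet_graph (A : Rigging B Dp Dm) (T : Dp →L[ℂ] Dm) :
    (A.bullet T).graph = A.bulletGraph T := by
  refine Submodule.toLinearPMap_graph_eq _ ?_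
  rintro ⟨x, u⟩ ⟨y, hy, hy'⟩ hx
  simp only at hx hy hy' ⊢
  subst hx
  have : y = 0 := A.injective_Ip (by simpa using hy)
  subst this
  exact A.injective_Im (by simpa using hy'.symm)

/-- `T^•` takes the value `u` at `x` exactly when `x = I⁺ y` and `T y = I⁻ u` for some `y`. -/
theorem bullet_eq_iff (A : Rigging B Dp Dm) (T : Dp →L[ℂ] Dm) (x u : B) :
    (∃ h : x ∈ (A.bullet T).domain, A.bullet T ⟨x, h⟩ = u) ↔
      ∃ y : Dp, A.Ip y = x ∧ T y = A.Im u := by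
  have : (x, u) ∈ (A.bullet T).graph ↔ (x, u) ∈ A.bulletGraph T := by rw [bullet_graph]
  refine Iff.trans ?_ this
  rw [LinearPMap.mem_graph_iff]
  constructor
  · rintro ⟨h, e⟩
    exact ⟨⟨x, h⟩, rfl, e⟩
  · rintro ⟨⟨y, h⟩, rfl, e⟩
    exact ⟨h, e⟩

end Rigging

/-! ### The adjoint space and adjoint operators -/

/-- The adjoint space `D^*` of bounded antilinear functionals on `D`. -/
abbrev AntiDual (D : Type*) [NormedAddCommGroup D] [NormedSpace ℂ D] : Type _ := D →L⋆[ℂ] ℂ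

/-- The operator `P^* : F^* → E^*`, `⟨P^* f, y⟩ = ⟨f, P y⟩`, for bounded `P : E → F`. -/
def antiDualMap {E F : Type*} [NormedAddCommGroup E] [NormedSpace ℂ E]
    [NormedAddCommGroup F] [NormedSpace ℂ F] (P : E →L[ℂ] F) : AntiDual F →L[ℂ] AntiDual E :=
  (ContinuousLinearMap.compSL E F ℂ (RingHom.id ℂ) (starRingEnd ℂ)).flip P

section Adjoint

variable {D H : Type*} [NormedAddCommGroup D] [InnerProductSpace ℂ D]
  [NormedAddCommGroup H] [InnerProductSpace ℂ H]

@[simp] theorem antiDualMap_apply {E F : Type*} [NormedAddCommGroup E] [NormedSpace ℂ E]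
    [NormedAddCommGroup F] [NormedSpace ℂ F] (P : E →L[ℂ] F) (f : AntiDual F) (y : E) :
    antiDualMap P f y = f (P y) := rfl

/-- The operator `I^* : H → D^*`, `⟨I^* x, y⟩ = ⟨x, I y⟩_H`, for bounded `I : D → H`.
(Mathlib's inner product is linear in its second argument.) -/
def starEmb (I : D →L[ℂ] H) : H →L[ℂ] AntiDual D := antiDualMap I ∘L innerSLFlip ℂ

@[simp] theorem starEmb_apply (I : D →L[ℂ] H) (x : H) (y : D) :
    starEmb I x y = ⟪I y, x⟫_ℂ := rfl

/-- The Riesz map is onto the antidual. -/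
theorem exists_riesz [CompleteSpace D] (f : AntiDual D) : ∃ x : D, f = innerSLFlip ℂ x := by
  let g : D →L[ℂ] ℂ := (starL ℂ : ℂ ≃L⋆[ℂ] ℂ).toContinuousLinearMap.comp f
  refine ⟨(InnerProductSpace.toDual ℂ D).symm g, ?_⟩
  ext y
  rw [innerSLFlip_apply_apply, ← inner_conj_symm, InnerProductSpace.toDual_symm_apply]
  simp [g]

/-- The rigging `D → H → D^*` generated by a dense injection `I` of Hilbert spaces. -/
def hilbertRigging [CompleteSpace D] [CompleteSpace H] (I : D →L[ℂ] H)
    (hI : Function.Injective I) (hd : DenseRange I) : Rigging H D (AntiDual D) where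
  Ip := I
  Im := starEmb I
  injective_Ip := hI
  injective_Im := by
    rw [injective_iff_map_eq_zero]
    intro x hx
    refine hd.eq_zero_of_inner_right (𝕜 := ℂ) fun y => ?_
    simpa using congrArg (fun f : AntiDual D => f y) hx
  denseRange_Ip := hd
  denseRange_Im := by
    have h1 : DenseRange (ContinuousLinearMap.adjoint I) := by
      have h : (ContinuousLinearMap.adjoint I).rangeᗮ = ⊥ := by
        rw [ContinuousLinearMap.orthogonal_range, ContinuousLinearMap.adjoint_adjoint]
        exact LinearMap.ker_eq_bot.2 hI
      have := (Submodule.topologicalClosure_eq_top_iff).2 h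
      rw [Submodule.dense_iff_topologicalClosure_eq_top.symm] at this
      exact this
    have h2 : DenseRange (innerSLFlip ℂ : D →L[ℂ] AntiDual D) := by
      refine Function.Surjective.denseRange fun f => ?_
      obtain ⟨x, hx⟩ := exists_riesz f
      exact ⟨x, hx.symm⟩
    have h3 := h2.comp h1 (innerSLFlip ℂ : D →L[ℂ] AntiDual D).continuous
    have h4 : (starEmb I : H → AntiDual D) =
        (innerSLFlip ℂ : D →L[ℂ] AntiDual D) ∘ ContinuousLinearMap.adjoint I := by
      funext x
      ext y
      simp [ContinuousLinearMap.adjoint_inner_right]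
    rw [h4]
    exact h3

end Adjoint

/-! ### Completion of a vector space with respect to a positive definite form -/

/-- The vector space `V` with the norm `⟨y, y⟩^{1/2}` of a given inner product. -/
def FormSpace {V : Type*} [AddCommGroup V] [Module ℂ V] (_c : InnerProductSpace.Core ℂ V) :
    Type _ := V

namespace FormSpace

variable {V : Type*} [AddCommGroup V] [Module ℂ V] (c : InnerProductSpace.Core ℂ V)

instance instNormedAddCommGroup : NormedAddCommGroup (FormSpace c) :=
  @InnerProductSpace.Core.toNormedAddCommGroup ℂ V _ _ _ c

instance instInnerProductSpace : InnerProductSpace ℂ (FormSpace c) :=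
  @InnerProductSpace.ofCore ℂ V _ _ _ c.toCore

/-- The canonical map of `V` into its completion. -/
def toCompletion : V →ₗ[ℂ] UniformSpace.Completion (FormSpace c) :=
  (UniformSpace.Completion.toComplL (𝕜 := ℂ) (E := FormSpace c)).toLinearMap

theorem denseRange_toCompletion : DenseRange (toCompletion c) :=
  UniformSpace.Completion.denseRange_coe (α := FormSpace c)

theorem inner_toCompletion (x y : V) :
    ⟪toCompletion c x, toCompletion c y⟫_ℂ = c.inner x y :=
  UniformSpace.Completion.inner_coe (𝕜 := ℂ) (E := FormSpace c) x y

theorem norm_sq_toCompletion (x : V) : ‖toCompletion c x‖ ^ 2 = (c.inner x x).re := by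
  rw [← inner_toCompletion, ← inner_self_eq_norm_sq (𝕜 := ℂ)]
  rfl

end FormSpace

theorem extendOfNorm_eq_of_apply {V D G : Type*} [AddCommGroup V] [Module ℂ V]
    [NormedAddCommGroup D] [NormedSpace ℂ D] [NormedAddCommGroup G] [NormedSpace ℂ G]
    [CompleteSpace G] {e : V →ₗ[ℂ] D} (he : DenseRange e) {f : V →ₗ[ℂ] G} (g : D →L[ℂ] G)
    (h : ∀ x, g (e x) = f x) : f.extendOfNorm e = g :=
  LinearMap.extendOfNorm_unique he ‖g‖ (fun x => h x ▸ g.le_opNorm _) g (LinearMap.ext h)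

/-! ### Operator matrices -/

/-- A `2 × 2` matrix of unbounded operators in `H₁ ⊕ H₂`; the entries of each column have the
same domain, namely `dom T₁₁` and `dom T₂₂` respectively. -/
structure OperatorMatrix (H₁ H₂ : Type*) [NormedAddCommGroup H₁] [InnerProductSpace ℂ H₁]
    [NormedAddCommGroup H₂] [InnerProductSpace ℂ H₂] where
  T₁₁ : H₁ →ₗ.[ℂ] H₁
  T₂₂ : H₂ →ₗ.[ℂ] H₂
  T₁₂ : T₂₂.domain →ₗ[ℂ] H₁
  T₂₁ : T₁₁.domain →ₗ[ℂ] H₂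

namespace OperatorMatrix

variable {H₁ H₂ : Type*} [NormedAddCommGroup H₁] [InnerProductSpace ℂ H₁]
  [NormedAddCommGroup H₂] [InnerProductSpace ℂ H₂]

/-- The operator in the Hilbert sum `H₁ ⊕ H₂` given by the matrix, with domain
`dom T₁₁ ⊕ dom T₂₂`. -/
def toPMap (M : OperatorMatrix H₁ H₂) :
    WithLp 2 (H₁ × H₂) →ₗ.[ℂ] WithLp 2 (H₁ × H₂) where
  domain := (M.T₁₁.domain.prod M.T₂₂.domain).comap (WithLp.linearEquiv 2 ℂ (H₁ × H₂)).toLinearMap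
  toFun :=
    { toFun := fun y => WithLp.toLp 2
        (M.T₁₁ ⟨y.1.fst, y.2.1⟩ + M.T₁₂ ⟨y.1.snd, y.2.2⟩,
          M.T₂₁ ⟨y.1.fst, y.2.1⟩ + M.T₂₂ ⟨y.1.snd, y.2.2⟩)
      map_add' := by
        rintro ⟨x, hx⟩ ⟨y, hy⟩
        have h1 : ∀ h, (⟨(x + y).fst, h⟩ : M.T₁₁.domain) = ⟨x.fst, hx.1⟩ + ⟨y.fst, hy.1⟩ :=
          fun _ => rfl
        have h2 : ∀ h, (⟨(x + y).snd, h⟩ : M.T₂₂.domain) = ⟨x.snd, hx.2⟩ + ⟨y.snd, hy.2⟩ :=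
          fun _ => rfl
        simp only [AddMemClass.mk_add_mk, h1, h2, map_add,
          LinearPMap.map_add, ← WithLp.toLp_add, Prod.mk_add_mk]
        congr 2 <;> abel
      map_smul' := by
        rintro c ⟨x, hx⟩
        have h1 : ∀ h, (⟨(c • x).fst, h⟩ : M.T₁₁.domain) = c • ⟨x.fst, hx.1⟩ := fun _ => rfl
        have h2 : ∀ h, (⟨(c • x).snd, h⟩ : M.T₂₂.domain) = c • ⟨x.snd, hx.2⟩ := fun _ => rfl
        simp only [SetLike.mk_smul_mk, h1, h2, map_smul, LinearPMap.map_smul, RingHom.id_apply,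
          ← WithLp.toLp_smul, Prod.smul_mk, smul_add] }

/-- The vector `(y, z)` of the domain of the matrix. -/
def domMk (M : OperatorMatrix H₁ H₂) (y : M.T₁₁.domain) (z : M.T₂₂.domain) : M.toPMap.domain :=
  ⟨WithLp.toLp 2 ((y : H₁), (z : H₂)), y.2, z.2⟩

end OperatorMatrix

/-- A symmetric (in particular densely defined) operator matrix in `H₁ ⊕ H₂` with constants
`κ` and `τ` such that `T₁₁ - κ ≥ 1` and `τ - T₂₂ ≥ 1`. -/
structure SemiboundedOperatorMatrix (H₁ H₂ : Type*) [NormedAddCommGroup H₁]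
    [InnerProductSpace ℂ H₁] [NormedAddCommGroup H₂] [InnerProductSpace ℂ H₂] extends
    OperatorMatrix H₁ H₂ where
  dense_domain : Dense (toOperatorMatrix.toPMap.domain : Set (WithLp 2 (H₁ × H₂)))
  symmetric : toOperatorMatrix.toPMap.IsFormalAdjoint toOperatorMatrix.toPMap
  κ : ℝ
  τ : ℝ
  lower_bound : ∀ y : T₁₁.domain, ‖(y : H₁)‖ ^ 2 ≤ (⟪(y : H₁), T₁₁ y - (κ : ℂ) • (y : H₁)⟫_ℂ).re
  upper_bound : ∀ y : T₂₂.domain, ‖(y : H₂)‖ ^ 2 ≤ (⟪(y : H₂), (τ : ℂ) • (y : H₂) - T₂₂ y⟫_ℂ).re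

namespace SemiboundedOperatorMatrix

variable {H₁ H₂ : Type*} [NormedAddCommGroup H₁] [InnerProductSpace ℂ H₁]
  [NormedAddCommGroup H₂] [InnerProductSpace ℂ H₂]
  (M : SemiboundedOperatorMatrix H₁ H₂)

theorem toPMap_domMk (y : M.T₁₁.domain) (z : M.T₂₂.domain) :
    M.toPMap (M.domMk y z) = WithLp.toLp 2 (M.T₁₁ y + M.T₁₂ z, M.T₂₁ y + M.T₂₂ z) := rfl

theorem symm_aux (y y' : M.T₁₁.domain) (z z' : M.T₂₂.domain) :
    ⟪M.T₁₁ y + M.T₁₂ z, (y' : H₁)⟫_ℂ + ⟪M.T₂₁ y + M.T₂₂ z, (z' : H₂)⟫_ℂ =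
      ⟪(y : H₁), M.T₁₁ y' + M.T₁₂ z'⟫_ℂ + ⟪(z : H₂), M.T₂₁ y' + M.T₂₂ z'⟫_ℂ := by
  have := M.symmetric (M.domMk y z) (M.domMk y' z')
  rw [toPMap_domMk, toPMap_domMk, WithLp.prod_inner_apply, WithLp.prod_inner_apply] at this
  exact this

theorem symm₁₁ (y y' : M.T₁₁.domain) : ⟪M.T₁₁ y, (y' : H₁)⟫_ℂ = ⟪(y : H₁), M.T₁₁ y'⟫_ℂ := by
  simpa using M.symm_aux y y' 0 0

theorem symm₂₂ (z z' : M.T₂₂.domain) : ⟪M.T₂₂ z, (z' : H₂)⟫_ℂ = ⟪(z : H₂), M.T₂₂ z'⟫_ℂ := by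
  simpa using M.symm_aux 0 0 z z'

theorem symm₁₂ (z : M.T₂₂.domain) (y : M.T₁₁.domain) :
    ⟪M.T₁₂ z, (y : H₁)⟫_ℂ = ⟪(z : H₂), M.T₂₁ y⟫_ℂ := by
  simpa using M.symm_aux 0 y z 0

theorem dense₁ : Dense (M.T₁₁.domain : Set H₁) := by
  intro x
  have h : WithLp.toLp 2 (x, (0 : H₂)) ∈ closure (M.toPMap.domain : Set (WithLp 2 (H₁ × H₂))) :=
    M.dense_domain _
  have := image_closure_subset_closure_image
    (WithLp.fstL 2 ℂ H₁ H₂).continuous ⟨_, h, rfl⟩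
  refine closure_mono ?_ this
  rintro _ ⟨y, hy, rfl⟩
  exact hy.1

theorem dense₂ : Dense (M.T₂₂.domain : Set H₂) := by
  intro x
  have h : WithLp.toLp 2 ((0 : H₁), x) ∈ closure (M.toPMap.domain : Set (WithLp 2 (H₁ × H₂))) :=
    M.dense_domain _
  have := image_closure_subset_closure_image
    (WithLp.sndL 2 ℂ H₁ H₂).continuous ⟨_, h, rfl⟩
  refine closure_mono ?_ this
  rintro _ ⟨y, hy, rfl⟩
  exact hy.2

/-- The form `⟨(τ - T₂₂) y, y⟩` on `dom T₂₂`. -/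
def core₂ : InnerProductSpace.Core ℂ M.T₂₂.domain where
  inner x y := ⟪(x : H₂), (M.τ : ℂ) • (y : H₂) - M.T₂₂ y⟫_ℂ
  conj_inner_symm x y := by
    rw [inner_conj_symm, inner_sub_left, inner_sub_right, inner_smul_left, inner_smul_right,
      M.symm₂₂, Complex.conj_ofReal]
  re_inner_nonneg x := (sq_nonneg _).trans (M.upper_bound x)
  add_left x y z := by rw [Submodule.coe_add, inner_add_left]
  smul_left x y r := by rw [Submodule.coe_smul, inner_smul_left]
  definite x hx := by
    have := M.upper_bound x
    rw [hx] at this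
    simpa using this

/-- The space `D₂`: the completion of `dom T₂₂` with respect to `⟨(τ - T₂₂) y, y⟩^{1/2}`. -/
abbrev D₂ : Type _ := UniformSpace.Completion (FormSpace M.core₂)

/-- The canonical map `dom T₂₂ → D₂`. -/
def e₂ : M.T₂₂.domain →ₗ[ℂ] M.D₂ := FormSpace.toCompletion M.core₂

theorem denseRange_e₂ : DenseRange M.e₂ := FormSpace.denseRange_toCompletion _

theorem inner_e₂ (x y : M.T₂₂.domain) :
    ⟪M.e₂ x, M.e₂ y⟫_ℂ = ⟪(x : H₂), (M.τ : ℂ) • (y : H₂) - M.T₂₂ y⟫_ℂ :=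
  FormSpace.inner_toCompletion M.core₂ x y

variable [CompleteSpace H₂]

/-- The embedding `I₂ : D₂ → H₂`, extending the inclusion of `dom T₂₂` by continuity. -/
def I₂ : M.D₂ →L[ℂ] H₂ := M.T₂₂.domain.subtype.extendOfNorm M.e₂

@[simp] theorem I₂_e₂ (y : M.T₂₂.domain) : M.I₂ (M.e₂ y) = y := by
  refine LinearMap.extendOfNorm_eq M.denseRange_e₂ ⟨1, fun y => ?_⟩ y
  rw [one_mul]
  refine abs_le_of_sq_le_sq' ?_ (norm_nonneg _) |>.2
  exact (M.upper_bound y).trans (FormSpace.norm_sq_toCompletion M.core₂ y).ge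

theorem inner_e₂_left (y : M.T₂₂.domain) (x : M.D₂) :
    ⟪M.e₂ y, x⟫_ℂ = ⟪(M.τ : ℂ) • (y : H₂) - M.T₂₂ y, M.I₂ x⟫_ℂ := by
  refine M.denseRange_e₂.induction_on x (isClosed_eq (by fun_prop) (by fun_prop)) fun z => ?_
  rw [inner_e₂, I₂_e₂, inner_sub_left, inner_sub_right, inner_smul_left, inner_smul_right,
      M.symm₂₂, Complex.conj_ofReal]

theorem injective_I₂ : Function.Injective M.I₂ := by
  rw [injective_iff_map_eq_zero]
  intro x hx
  refine M.denseRange_e₂.eq_zero_of_inner_right (𝕜 := ℂ) fun y => ?_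
  rw [inner_e₂_left, hx, inner_zero_right]

theorem denseRange_I₂ : DenseRange M.I₂ := by
  refine M.dense₂.mono ?_
  intro y hy
  exact ⟨M.e₂ ⟨y, hy⟩, M.I₂_e₂ _⟩

/-- The rigging `D₂ → H₂ → D₂^*`. -/
def rigging₂ : Rigging H₂ M.D₂ (AntiDual M.D₂) :=
  hilbertRigging M.I₂ M.injective_I₂ M.denseRange_I₂

/-- The bounded operator `D₂ → D₂^*` which is the extension by continuity (equivalently, the
closure) of `I₂^* T₂₂ I₂`. -/
def block₂₂ : M.D₂ →L[ℂ] AntiDual M.D₂ :=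
  ((starEmb M.I₂).toLinearMap ∘ₗ M.T₂₂.toFun).extendOfNorm M.e₂

theorem block₂₂_aux (y : M.T₂₂.domain) :
    ((M.τ : ℂ) • (starEmb M.I₂ ∘L M.I₂) - innerSLFlip ℂ : M.D₂ →L[ℂ] AntiDual M.D₂) (M.e₂ y) =
      starEmb M.I₂ (M.T₂₂ y) := by
  ext z
  have h' := congrArg (starRingEnd ℂ) (M.inner_e₂_left y z)
  simp only [inner_conj_symm] at h'
  simp only [sub_apply, smul_apply, ContinuousLinearMap.comp_apply, starEmb_apply,
    innerSLFlip_apply_apply, h', I₂_e₂, inner_sub_right, inner_smul_right, smul_eq_mul]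
  ring

theorem block₂₂_eq : M.block₂₂ = (M.τ : ℂ) • (starEmb M.I₂ ∘L M.I₂) - innerSLFlip ℂ :=
  extendOfNorm_eq_of_apply M.denseRange_e₂ _ M.block₂₂_aux

@[simp] theorem block₂₂_e₂ (y : M.T₂₂.domain) :
    M.block₂₂ (M.e₂ y) = starEmb M.I₂ (M.T₂₂ y) := by
  rw [block₂₂_eq, block₂₂_aux]

/-- The Friedrichs extension of `T₂₂` associated with the space `D₂`. -/
def friedrichs₂₂ : H₂ →ₗ.[ℂ] H₂ := M.rigging₂.bullet M.block₂₂

/-- The operator `(τ - T₂₂^•)⁻¹`, where `T₂₂^•` is the Friedrichs extension of `T₂₂`. -/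
def resolvent₂₂ : H₂ →L[ℂ] H₂ := boundedInverse (-(pmapSub M.friedrichs₂₂ M.τ))

theorem isBoundedInverse_friedrichs : IsBoundedInverse (-(pmapSub M.friedrichs₂₂ M.τ))
    (M.I₂ ∘L ContinuousLinearMap.adjoint M.I₂) := by
  have key : ∀ (y : M.D₂) (u : H₂), M.block₂₂ y = starEmb M.I₂ u ↔
      y = ContinuousLinearMap.adjoint M.I₂ ((M.τ : ℂ) • M.I₂ y - u) := by
    intro y u
    rw [block₂₂_eq]
    constructor
    · intro h
      refine ext_inner_left ℂ fun z => ?_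
      have := congrArg (fun f : AntiDual M.D₂ => f z) h
      simp only [sub_apply, smul_apply, ContinuousLinearMap.comp_apply, starEmb_apply,
        innerSLFlip_apply_apply, smul_eq_mul] at this
      rw [ContinuousLinearMap.adjoint_inner_right, inner_sub_right, inner_smul_right, ← this]
      ring
    · intro h
      ext z
      have : ⟪z, y⟫_ℂ = ⟪M.I₂ z, (M.τ : ℂ) • M.I₂ y - u⟫_ℂ := by
        rw [← ContinuousLinearMap.adjoint_inner_right, ← h]
      simp only [sub_apply, smul_apply, ContinuousLinearMap.comp_apply, starEmb_apply,
        innerSLFlip_apply_apply, smul_eq_mul, this, inner_sub_right, inner_smul_right]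
      ring
  constructor
  · intro x
    obtain ⟨h, e⟩ := (M.rigging₂.bullet_eq_iff M.block₂₂
      (M.I₂ (ContinuousLinearMap.adjoint M.I₂ x))
      ((M.τ : ℂ) • M.I₂ (ContinuousLinearMap.adjoint M.I₂ x) - x)).2
      ⟨ContinuousLinearMap.adjoint M.I₂ x, rfl, (key _ _).2 (by rw [sub_sub_cancel])⟩
    refine ⟨h, ?_⟩
    change -(M.rigging₂.bullet M.block₂₂ ⟨_, h⟩ - (M.τ : ℂ) • _) = x
    rw [e]
    simp
  · rintro ⟨x, hx⟩
    obtain ⟨y, hy, hy'⟩ := (M.rigging₂.bullet_eq_iff M.block₂₂ x _).1 ⟨hx, rfl⟩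
    have h := (key y _).1 hy'
    change M.I₂ (ContinuousLinearMap.adjoint M.I₂
      (-(M.rigging₂.bullet M.block₂₂ ⟨x, hx⟩ - (M.τ : ℂ) • x))) = x
    have hy2 : M.I₂ y = x := hy
    rw [neg_sub]
    rw [hy2] at h
    rw [← h, hy2]

theorem resolvent₂₂_eq : M.resolvent₂₂ = M.I₂ ∘L ContinuousLinearMap.adjoint M.I₂ :=
  boundedInverse_eq M.isBoundedInverse_friedrichs

theorem inner_resolvent₂₂ (x y : H₂) : ⟪x, M.resolvent₂₂ y⟫_ℂ =
    ⟪ContinuousLinearMap.adjoint M.I₂ x, ContinuousLinearMap.adjoint M.I₂ y⟫_ℂ := by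
  rw [resolvent₂₂_eq, ContinuousLinearMap.comp_apply, ContinuousLinearMap.adjoint_inner_left]

/-- The form `⟨(T₁₁ - κ) y, y⟩ + ⟨(τ - T₂₂^•)⁻¹ T₂₁ y, T₂₁ y⟩` on `dom T₁₁`. -/
def core₁ : InnerProductSpace.Core ℂ M.T₁₁.domain where
  inner x y := ⟪(x : H₁), M.T₁₁ y - (M.κ : ℂ) • (y : H₁)⟫_ℂ +
    ⟪M.T₂₁ x, M.resolvent₂₂ (M.T₂₁ y)⟫_ℂ
  conj_inner_symm x y := by
    rw [map_add, inner_conj_symm, inner_sub_left, inner_sub_right, inner_smul_left,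
      inner_smul_right, M.symm₁₁, Complex.conj_ofReal, inner_resolvent₂₂, inner_resolvent₂₂,
      inner_conj_symm]
  re_inner_nonneg x := by
    rw [inner_resolvent₂₂, map_add]
    exact add_nonneg ((sq_nonneg _).trans (M.lower_bound x)) inner_self_nonneg
  add_left x y z := by
    rw [Submodule.coe_add, map_add, inner_add_left, inner_add_left]
    ring
  smul_left x y r := by
    rw [Submodule.coe_smul, map_smul, inner_smul_left, inner_smul_left]
    ring
  definite x hx := by
    have h := M.lower_bound x
    rw [inner_resolvent₂₂] at hx
    have h1 := congrArg Complex.re hx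
    have h2 : 0 ≤ (⟪ContinuousLinearMap.adjoint M.I₂ (M.T₂₁ x),
      ContinuousLinearMap.adjoint M.I₂ (M.T₂₁ x)⟫_ℂ).re := inner_self_nonneg (𝕜 := ℂ)
    rw [Complex.add_re, Complex.zero_re] at h1
    have h3 : ‖(x : H₁)‖ ^ 2 ≤ 0 := by linarith
    simpa using h3

/-- The space `D₁`: the completion of `dom T₁₁` with respect to the norm
`(⟨(T₁₁ - κ) y, y⟩ + ⟨(τ - T₂₂^•)⁻¹ T₂₁ y, T₂₁ y⟩)^{1/2}`. -/
abbrev D₁ : Type _ := UniformSpace.Completion (FormSpace M.core₁)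

/-- The canonical map `dom T₁₁ → D₁`. -/
def e₁ : M.T₁₁.domain →ₗ[ℂ] M.D₁ := FormSpace.toCompletion M.core₁

theorem denseRange_e₁ : DenseRange M.e₁ := FormSpace.denseRange_toCompletion _

theorem inner_e₁ (x y : M.T₁₁.domain) :
    ⟪M.e₁ x, M.e₁ y⟫_ℂ = ⟪(x : H₁), M.T₁₁ y - (M.κ : ℂ) • (y : H₁)⟫_ℂ +
      ⟪ContinuousLinearMap.adjoint M.I₂ (M.T₂₁ x),
        ContinuousLinearMap.adjoint M.I₂ (M.T₂₁ y)⟫_ℂ := by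
  rw [← inner_resolvent₂₂]
  exact FormSpace.inner_toCompletion M.core₁ x y

theorem norm_e₁ (x : M.T₁₁.domain) : ‖M.e₁ x‖ ^ 2 =
    (⟪(x : H₁), M.T₁₁ x - (M.κ : ℂ) • (x : H₁)⟫_ℂ).re +
      ‖ContinuousLinearMap.adjoint M.I₂ (M.T₂₁ x)‖ ^ 2 := by
  rw [← inner_self_eq_norm_sq (𝕜 := ℂ), ← inner_self_eq_norm_sq (𝕜 := ℂ), inner_e₁, map_add]
  rfl

/-- Auxiliary: the extension by continuity of `y ↦ I₂† T₂₁ y` to `D₁`, with `I₂†` the Hilbert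
space adjoint of `I₂`. -/
def K : M.D₁ →L[ℂ] M.D₂ :=
  ((ContinuousLinearMap.adjoint M.I₂).toLinearMap ∘ₗ M.T₂₁).extendOfNorm M.e₁

@[simp] theorem K_e₁ (y : M.T₁₁.domain) :
    M.K (M.e₁ y) = ContinuousLinearMap.adjoint M.I₂ (M.T₂₁ y) := by
  refine LinearMap.extendOfNorm_eq M.denseRange_e₁ ⟨1, fun y => ?_⟩ y
  rw [one_mul]
  refine abs_le_of_sq_le_sq' ?_ (norm_nonneg _) |>.2
  rw [norm_e₁]
  have := (sq_nonneg _).trans (M.lower_bound y)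
  simp only [LinearMap.comp_apply, ContinuousLinearMap.coe_coe]
  linarith

variable [CompleteSpace H₁]

/-- The embedding `I₁ : D₁ → H₁`, extending the inclusion of `dom T₁₁` by continuity. -/
def I₁ : M.D₁ →L[ℂ] H₁ := M.T₁₁.domain.subtype.extendOfNorm M.e₁

@[simp] theorem I₁_e₁ (y : M.T₁₁.domain) : M.I₁ (M.e₁ y) = y := by
  refine LinearMap.extendOfNorm_eq M.denseRange_e₁ ⟨1, fun y => ?_⟩ y
  rw [one_mul]
  refine abs_le_of_sq_le_sq' ?_ (norm_nonneg _) |>.2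
  rw [norm_e₁]
  have := M.lower_bound y
  have h2 := sq_nonneg ‖ContinuousLinearMap.adjoint M.I₂ (M.T₂₁ y)‖
  simp only [Submodule.subtype_apply]
  linarith

theorem inner_e₁_left (y : M.T₁₁.domain) (x : M.D₁) :
    ⟪M.e₁ y, x⟫_ℂ = ⟪M.T₁₁ y - (M.κ : ℂ) • (y : H₁), M.I₁ x⟫_ℂ + ⟪M.K (M.e₁ y), M.K x⟫_ℂ := by
  refine M.denseRange_e₁.induction_on x (isClosed_eq (by fun_prop) (by fun_prop)) fun z => ?_
  rw [inner_e₁, I₁_e₁, K_e₁, K_e₁, inner_sub_left, inner_sub_right, inner_smul_left,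
    inner_smul_right, M.symm₁₁, Complex.conj_ofReal]

theorem inner_e₂_K (z : M.T₂₂.domain) (x : M.D₁) :
    ⟪M.e₂ z, M.K x⟫_ℂ = ⟪M.T₁₂ z, M.I₁ x⟫_ℂ := by
  refine M.denseRange_e₁.induction_on x (isClosed_eq (by fun_prop) (by fun_prop)) fun y => ?_
  rw [I₁_e₁, K_e₁, ContinuousLinearMap.adjoint_inner_right, I₂_e₂, symm₁₂]

theorem injective_I₁ : Function.Injective M.I₁ := by
  rw [injective_iff_map_eq_zero]
  intro x hx
  have hK : M.K x = 0 := M.denseRange_e₂.eq_zero_of_inner_right (𝕜 := ℂ) fun z => by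
    rw [inner_e₂_K, hx, inner_zero_right]
  refine M.denseRange_e₁.eq_zero_of_inner_right (𝕜 := ℂ) fun y => ?_
  rw [inner_e₁_left, hx, hK, inner_zero_right, inner_zero_right, add_zero]

theorem denseRange_I₁ : DenseRange M.I₁ := by
  refine M.dense₁.mono ?_
  intro y hy
  exact ⟨M.e₁ ⟨y, hy⟩, M.I₁_e₁ _⟩

/-- The bounded operator `D₁ → D₁^*` extending `I₁^* T₁₁ I₁` by continuity. -/
def block₁₁ : M.D₁ →L[ℂ] AntiDual M.D₁ :=
  ((starEmb M.I₁).toLinearMap ∘ₗ M.T₁₁.toFun).extendOfNorm M.e₁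

/-- The bounded operator `D₁ → D₂^*` extending `I₂^* T₂₁ I₁` by continuity. -/
def block₂₁ : M.D₁ →L[ℂ] AntiDual M.D₂ :=
  ((starEmb M.I₂).toLinearMap ∘ₗ M.T₂₁).extendOfNorm M.e₁

/-- The bounded operator `D₂ → D₁^*` extending `I₁^* T₁₂ I₂` by continuity. -/
def block₁₂ : M.D₂ →L[ℂ] AntiDual M.D₁ :=
  ((starEmb M.I₁).toLinearMap ∘ₗ M.T₁₂).extendOfNorm M.e₂

theorem exists_block₁₁ : ∃ g : M.D₁ →L[ℂ] AntiDual M.D₁,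
    ∀ y, g (M.e₁ y) = starEmb M.I₁ (M.T₁₁ y) := by
  refine ⟨innerSLFlip ℂ + (M.κ : ℂ) • (starEmb M.I₁ ∘L M.I₁) - starEmb M.K ∘L M.K, fun y => ?_⟩
  ext x
  have h' := congrArg (starRingEnd ℂ) (M.inner_e₁_left y x)
  simp only [map_add, inner_conj_symm] at h'
  simp only [sub_apply, add_apply,
    smul_apply, ContinuousLinearMap.comp_apply, starEmb_apply,
    innerSLFlip_apply_apply, h', I₁_e₁, inner_sub_right, inner_smul_right, smul_eq_mul]
  ring

theorem exists_block₂₁ : ∃ g : M.D₁ →L[ℂ] AntiDual M.D₂,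
    ∀ y, g (M.e₁ y) = starEmb M.I₂ (M.T₂₁ y) := by
  refine ⟨innerSLFlip ℂ ∘L M.K, fun y => ?_⟩
  ext x
  simp [ContinuousLinearMap.adjoint_inner_right]

theorem exists_block₁₂ : ∃ g : M.D₂ →L[ℂ] AntiDual M.D₁,
    ∀ y, g (M.e₂ y) = starEmb M.I₁ (M.T₁₂ y) := by
  refine ⟨starEmb M.K, fun y => ?_⟩
  ext x
  have h' := congrArg (starRingEnd ℂ) (M.inner_e₂_K y x)
  simpa only [inner_conj_symm, starEmb_apply] using h'

@[simp] theorem block₁₁_e₁ (y : M.T₁₁.domain) :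
    M.block₁₁ (M.e₁ y) = starEmb M.I₁ (M.T₁₁ y) := by
  obtain ⟨g, hg⟩ := M.exists_block₁₁
  rw [block₁₁, extendOfNorm_eq_of_apply M.denseRange_e₁ g hg, hg]

@[simp] theorem block₂₁_e₁ (y : M.T₁₁.domain) :
    M.block₂₁ (M.e₁ y) = starEmb M.I₂ (M.T₂₁ y) := by
  obtain ⟨g, hg⟩ := M.exists_block₂₁
  rw [block₂₁, extendOfNorm_eq_of_apply M.denseRange_e₁ g hg, hg]

@[simp] theorem block₁₂_e₂ (y : M.T₂₂.domain) :
    M.block₁₂ (M.e₂ y) = starEmb M.I₁ (M.T₁₂ y) := by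
  obtain ⟨g, hg⟩ := M.exists_block₁₂
  rw [block₁₂, extendOfNorm_eq_of_apply M.denseRange_e₂ g hg, hg]

/-- The Hilbert space `D = D₁ ⊕ D₂`. -/
abbrev D : Type _ := WithLp 2 (M.D₁ × M.D₂)

/-- The embedding `I = I₁ ⊕ I₂ : D → H`. -/
def I : M.D →L[ℂ] WithLp 2 (H₁ × H₂) :=
  (WithLp.prodContinuousLinearEquiv 2 ℂ H₁ H₂).symm.toContinuousLinearMap ∘L
    (M.I₁.prodMap M.I₂) ∘L
      (WithLp.prodContinuousLinearEquiv 2 ℂ M.D₁ M.D₂).toContinuousLinearMap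

theorem I_apply (y : M.D) : M.I y = WithLp.toLp 2 (M.I₁ y.fst, M.I₂ y.snd) := rfl

theorem injective_I : Function.Injective M.I := by
  intro x y h
  rw [I_apply, I_apply] at h
  have h1 := M.injective_I₁ (congrArg WithLp.fst h)
  have h2 := M.injective_I₂ (congrArg WithLp.snd h)
  exact (WithLp.equiv 2 _).injective (Prod.ext h1 h2)

theorem denseRange_I : DenseRange M.I := by
  refine M.dense_domain.mono ?_
  intro y hy
  refine ⟨WithLp.toLp 2 (M.e₁ ⟨y.fst, hy.1⟩, M.e₂ ⟨y.snd, hy.2⟩), ?_⟩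
  rw [I_apply]
  change WithLp.toLp 2 (M.I₁ (M.e₁ _), M.I₂ (M.e₂ _)) = y
  rw [I₁_e₁, I₂_e₂]
  rfl

/-- The rigging `D → H → D^*` with the injections `I` and `I^*`. -/
def rigging : Rigging (WithLp 2 (H₁ × H₂)) M.D (AntiDual M.D) :=
  hilbertRigging M.I M.injective_I M.denseRange_I

/-- The bounded operator `T : D → D^*` with the blocks `T₁₁, T₁₂, T₂₁, T₂₂`. -/
def T : M.D →L[ℂ] AntiDual M.D :=
  antiDualMap (WithLp.fstL 2 ℂ M.D₁ M.D₂) ∘L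
      (M.block₁₁ ∘L WithLp.fstL 2 ℂ M.D₁ M.D₂ + M.block₁₂ ∘L WithLp.sndL 2 ℂ M.D₁ M.D₂) +
    antiDualMap (WithLp.sndL 2 ℂ M.D₁ M.D₂) ∘L
      (M.block₂₁ ∘L WithLp.fstL 2 ℂ M.D₁ M.D₂ + M.block₂₂ ∘L WithLp.sndL 2 ℂ M.D₁ M.D₂)

/-- `T` extends the (densely defined) operator `I^* T° I`, where `T°` is the given matrix. -/
theorem T_apply_core (y : M.T₁₁.domain) (z : M.T₂₂.domain) :
    M.T (WithLp.toLp 2 (M.e₁ y, M.e₂ z)) = starEmb M.I (M.toPMap (M.domMk y z)) := by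
  ext w
  simp [T, toPMap_domMk, I_apply, inner_add_right]

/-- The angular extension `T^• = (I^*)⁻¹ T I⁻¹` of the operator matrix. -/
def angularExtension : WithLp 2 (H₁ × H₂) →ₗ.[ℂ] WithLp 2 (H₁ × H₂) := M.rigging.bullet M.T

/-- The pencil `T^♮(c) = T - c I^* I` of bounded operators `D → D^*`. -/
def pencil (c : ℂ) : M.D →L[ℂ] AntiDual M.D := M.T - c • (starEmb M.I ∘L M.I)

end SemiboundedOperatorMatrix

end

/-! Everything rests on one fact: after subtracting `I^* diag(κ, τ) I`, the operator `T : D → D^*`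
becomes surjective. Let `K : D₁ → D₂` extend `I₂† T₂₁`. Under the Riesz identification the shifted
operator is the matrix with rows `(1 - K†K, K†)` and `(K, -1)`. The Schur complement of its lower
right entry is `1 - K†K + K†K = 1`, so the system is solved explicitly
(`T_sub_diagShift_surjective`). The norm of `D₁` contains the resolvent term exactly to make this
cancellation happen.

The rest is an argument about riggings. The subtracted operator factors through `H`, so it changes
solvability of `P y = f`, with `P = T - c I^* I`, only by right-hand sides in the range of `I^*`.
Those are the ones that a resolvent of the unbounded operator `T^•` handles, and so a resolvent at
`c` gives an inverse of `P` (`mem_pmapResolventSet_bullet_iff`). In the other direction the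
resolvent is `I P⁻¹ I^*`. Multiplicities agree because `I` maps `ker P` bijectively onto `ker (T^• -
c)`. -/

open scoped InnerProductSpace

universe u

/-! ### Abstract riggings: the operator in `B` versus the pencil `D⁺ → D⁻` -/

namespace Rigging

variable {B Dp Dm : Type*} [NormedAddCommGroup B] [NormedSpace ℂ B]
  [NormedAddCommGroup Dp] [NormedSpace ℂ Dp] [NormedAddCommGroup Dm] [NormedSpace ℂ Dm]

theorem exists_bullet_eq (A : Rigging B Dp Dm) (T : Dp →L[ℂ] Dm) {y : Dp} {u : B}
    (h : T y = A.Im u) : ∃ hx : A.Ip y ∈ (A.bullet T).domain, A.bullet T ⟨A.Ip y, hx⟩ = u :=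
  (A.bullet_eq_iff T _ _).2 ⟨y, rfl, h⟩

theorem exists_of_mem_domain (A : Rigging B Dp Dm) (T : Dp →L[ℂ] Dm) (x : (A.bullet T).domain) :
    ∃ y : Dp, A.Ip y = x ∧ T y = A.Im (A.bullet T x) :=
  (A.bullet_eq_iff T _ _).1 ⟨x.2, rfl⟩

/-- The bridge between the two sides: subtracting `c` in `B` commutes with passing to `T^•`, since
for `x = I⁺ y` the map `I⁻` sends `c x` to `c I⁻ I⁺ y`. Kernels and resolvents are both compared
through it. -/
theorem pmapSub_bullet_eq_iff (A : Rigging B Dp Dm) (T : Dp →L[ℂ] Dm) (c : ℂ) (x u : B) :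
    (∃ h : x ∈ (pmapSub (A.bullet T) c).domain, pmapSub (A.bullet T) c ⟨x, h⟩ = u) ↔
      ∃ y : Dp, A.Ip y = x ∧ (T - c • (A.Im ∘L A.Ip)) y = A.Im u := by
  constructor
  · rintro ⟨h, rfl⟩
    obtain ⟨y, hy, hy'⟩ := A.exists_of_mem_domain T ⟨x, h⟩
    refine ⟨y, hy, ?_⟩
    change T y - c • A.Im (A.Ip y) = A.Im (A.bullet T ⟨x, h⟩ - c • x)
    rw [hy', hy, map_sub, map_smul]
  · rintro ⟨y, rfl, hy⟩
    have hT : T y = A.Im (u + c • A.Ip y) := by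
      rw [map_add, map_smul, ← hy]
      simp
    obtain ⟨h, e⟩ := A.exists_bullet_eq T hT
    refine ⟨h, ?_⟩
    change A.bullet T ⟨_, h⟩ - c • A.Ip y = u
    rw [e, add_sub_cancel_right]

/-- If `T` is a perturbation of a surjection by an operator factoring through `B`, then the
spectra of `T^•` and of the pencil `T - c I⁻ I⁺` coincide. -/
theorem mem_pmapResolventSet_bullet_iff [CompleteSpace Dp] [CompleteSpace Dm]
    (A : Rigging B Dp Dm) (T : Dp →L[ℂ] Dm) (C : B →L[ℂ] B)
    (hC : Function.Surjective (T - A.Im ∘L C ∘L A.Ip)) (c : ℂ) :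
    c ∈ pmapResolventSet (A.bullet T) ↔ (T - c • (A.Im ∘L A.Ip)).IsInvertible := by
  set P := T - c • (A.Im ∘L A.Ip) with hP
  constructor
  · rintro ⟨R, hR, hR'⟩
    have hinj : P.ker = ⊥ := by
      rw [LinearMap.ker_eq_bot']
      intro y hy
      obtain ⟨h, e⟩ := (A.pmapSub_bullet_eq_iff T c (A.Ip y) 0).2 ⟨y, rfl, by
        rw [map_zero]; exact hy⟩
      have := hR' ⟨_, h⟩
      rw [e, map_zero] at this
      exact A.injective_Ip (by rw [map_zero]; exact this.symm)
    have hsurj : P.range = ⊤ := by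
      rw [LinearMap.range_eq_top]
      intro f
      obtain ⟨y, hy⟩ := hC f
      -- With `f = (T - I⁻ C I⁺) y`, the error `P y - f = I⁻ (C - c) I⁺ y` lies in the range of
      -- `I⁻`. The resolvent supplies a `z` with `P z` equal to this error, and `y - z` then solves
      -- the equation for `f`.
      obtain ⟨z, -, hz⟩ := (A.pmapSub_bullet_eq_iff T c _ _).1 (hR (C (A.Ip y) - c • A.Ip y))
      refine ⟨y - z, ?_⟩
      have hz' : P z = A.Im (C (A.Ip y) - c • A.Ip y) := hz
      have hy' : T y - A.Im (C (A.Ip y)) = f := hy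
      change P (y - z) = f
      rw [map_sub, hz', ← hy', map_sub, map_smul, hP]
      change T y - c • A.Im (A.Ip y) - _ = _
      abel
    -- Boundedness of the inverse is the open mapping theorem; this is where completeness of `D⁺`
    -- and `D⁻` enters.
    exact ⟨ContinuousLinearEquiv.ofBijective P hinj hsurj, by ext; simp⟩
  · rintro ⟨e, he⟩
    have hPe : ∀ y, P y = e y := fun y => by rw [← he]; rfl
    refine ⟨A.Ip ∘L (e.symm : Dm →L[ℂ] Dp) ∘L A.Im, fun x => ?_, fun x => ?_⟩
    · exact (A.pmapSub_bullet_eq_iff T c _ x).2 ⟨e.symm (A.Im x), rfl, by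
        rw [← hP, hPe, ContinuousLinearEquiv.apply_symm_apply]⟩
    · obtain ⟨y, hy, hy'⟩ := (A.pmapSub_bullet_eq_iff T c x _).1 ⟨x.2, rfl⟩
      rw [← hP, hPe] at hy'
      change A.Ip (e.symm (A.Im _)) = _
      rw [← hy, ← hy', ContinuousLinearEquiv.symm_apply_apply]

/-- `I⁺` restricts to an isomorphism of the two kernels: it is injective, and it is onto by the
description of the graph with `u = 0`. `B` and `D⁺` share a universe so that the two cardinals can
be equated. -/
theorem rank_ker_eq_pmapMultiplicity_bullet {B Dp : Type u} {Dm : Type*}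
    [NormedAddCommGroup B] [NormedSpace ℂ B] [NormedAddCommGroup Dp] [NormedSpace ℂ Dp]
    [NormedAddCommGroup Dm] [NormedSpace ℂ Dm]
    (A : Rigging B Dp Dm) (T : Dp →L[ℂ] Dm) (c : ℂ) :
    pmapMultiplicity (A.bullet T) c =
      Module.rank ℂ (LinearMap.ker (T - c • (A.Im ∘L A.Ip)).toLinearMap) := by
  have key : ∀ y : LinearMap.ker (T - c • (A.Im ∘L A.Ip)).toLinearMap,
      ∃ h : A.Ip y ∈ (pmapSub (A.bullet T) c).domain,
        pmapSub (A.bullet T) c ⟨A.Ip y, h⟩ = 0 := fun y =>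
    (A.pmapSub_bullet_eq_iff T c _ 0).2 ⟨y, rfl, by rw [map_zero]; exact y.2⟩
  let φ : LinearMap.ker (T - c • (A.Im ∘L A.Ip)).toLinearMap →ₗ[ℂ]
      pmapEigenspace (A.bullet T) c :=
    { toFun := fun y => ⟨⟨A.Ip y, (key y).1⟩, (key y).2⟩
      map_add' := fun y z => Subtype.ext (Subtype.ext (map_add A.Ip _ _))
      map_smul' := fun a y => Subtype.ext (Subtype.ext (map_smul A.Ip _ _)) }
  refine (LinearEquiv.rank_eq (LinearEquiv.ofBijective φ ⟨fun y z h => ?_, ?_⟩)).symm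
  · exact Subtype.ext (A.injective_Ip
      (congrArg (fun x : pmapEigenspace (A.bullet T) c => ((x : (A.bullet T).domain) : B)) h))
  · rintro ⟨x, hx⟩
    obtain ⟨y, hy, hy'⟩ := (A.pmapSub_bullet_eq_iff T c x 0).1 ⟨x.2, hx⟩
    rw [map_zero] at hy'
    exact ⟨⟨y, hy'⟩, Subtype.ext (Subtype.ext hy)⟩

end Rigging

/-! ### The operator matrix: explicit blocks and the surjective shift -/

namespace SemiboundedOperatorMatrix

variable {H₁ H₂ : Type*} [NormedAddCommGroup H₁] [InnerProductSpace ℂ H₁]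
  [NormedAddCommGroup H₂] [InnerProductSpace ℂ H₂]
  (M : SemiboundedOperatorMatrix H₁ H₂)

/-- The operator `diag(κ, τ)` in `H₁ ⊕ H₂`. -/
def diagShift : WithLp 2 (H₁ × H₂) →L[ℂ] WithLp 2 (H₁ × H₂) :=
  (WithLp.prodContinuousLinearEquiv 2 ℂ H₁ H₂).symm.toContinuousLinearMap ∘L
    (((M.κ : ℂ) • ContinuousLinearMap.id ℂ H₁).prodMap
      ((M.τ : ℂ) • ContinuousLinearMap.id ℂ H₂)) ∘L
      (WithLp.prodContinuousLinearEquiv 2 ℂ H₁ H₂).toContinuousLinearMap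

theorem diagShift_apply (x : WithLp 2 (H₁ × H₂)) :
    M.diagShift x = WithLp.toLp 2 ((M.κ : ℂ) • x.fst, (M.τ : ℂ) • x.snd) := rfl

variable [CompleteSpace H₂]

/-- On the dense image of `dom T₁₁` the functional `I₂^* T₂₁ y` is represented by the vector `I₂†
T₂₁ y = K y`. -/
theorem block₂₁_eq : M.block₂₁ = innerSLFlip ℂ ∘L M.K := by
  refine extendOfNorm_eq_of_apply M.denseRange_e₁ _ fun y => ?_
  ext x
  simp [ContinuousLinearMap.adjoint_inner_right]

variable [CompleteSpace H₁]

/-- The inner product of `D₁` is the form of `T₁₁ - κ` plus `⟨K·, K·⟩`; solving for the form of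
`T₁₁` produces the term `-K^* K`. -/
theorem block₁₁_eq : M.block₁₁ =
    innerSLFlip ℂ + (M.κ : ℂ) • (starEmb M.I₁ ∘L M.I₁) - starEmb M.K ∘L M.K := by
  refine extendOfNorm_eq_of_apply M.denseRange_e₁ _ fun y => ?_
  ext x
  -- The conjugate is taken because the antidual pairing puts the test vector in the first slot of
  -- the inner product.
  have h' := congrArg (starRingEnd ℂ) (M.inner_e₁_left y x)
  simp only [map_add, inner_conj_symm] at h'
  simp only [sub_apply, add_apply, LinearMap.comp_apply, ContinuousLinearMap.coe_coe,
    smul_apply, ContinuousLinearMap.comp_apply, starEmb_apply,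
    innerSLFlip_apply_apply, h', I₁_e₁, inner_sub_right, inner_smul_right, smul_eq_mul,
    LinearPMap.toFun_eq_coe]
  ring

/-- Symmetry of the matrix makes `T₁₂` the formal adjoint of `T₂₁`, which on the completions becomes
`inner_e₂_K`. -/
theorem block₁₂_eq : M.block₁₂ = starEmb M.K := by
  refine extendOfNorm_eq_of_apply M.denseRange_e₂ _ fun y => ?_
  ext x
  have h' := congrArg (starRingEnd ℂ) (M.inner_e₂_K y x)
  simpa only [inner_conj_symm, starEmb_apply, LinearMap.comp_apply,
    ContinuousLinearMap.coe_coe] using h'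

theorem T_apply (y w : M.D) : M.T y w =
    ⟪w.fst, y.fst⟫_ℂ + M.κ * ⟪M.I₁ w.fst, M.I₁ y.fst⟫_ℂ - ⟪M.K w.fst, M.K y.fst⟫_ℂ +
      ⟪M.K w.fst, y.snd⟫_ℂ + ⟪w.snd, M.K y.fst⟫_ℂ +
      (M.τ * ⟪M.I₂ w.snd, M.I₂ y.snd⟫_ℂ - ⟪w.snd, y.snd⟫_ℂ) := by
  simp [T, block₁₁_eq, block₁₂_eq, block₂₁_eq, block₂₂_eq]
  ring

/-- The shift by `diag(κ, τ)` removes exactly the terms of `T` containing `I₁` and `I₂`, leaving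
only inner products in `D₁` and `D₂`. -/
theorem T_sub_diagShift_surjective :
    Function.Surjective (M.T - starEmb M.I ∘L M.diagShift ∘L M.I) := by
  intro f
  obtain ⟨x, rfl⟩ := exists_riesz f
  -- The second row `K y₁ - y₂ = x₂` forces `y₂ = K y₁ - x₂`. Substituted into the first row, it
  -- cancels `K†K y₁` and leaves `y₁ = x₁ + K† x₂`.
  set y₁ := x.fst + ContinuousLinearMap.adjoint M.K x.snd with hy₁
  refine ⟨WithLp.toLp 2 (y₁, M.K y₁ - x.snd), ?_⟩
  ext w
  have h : ⟪w.fst, y₁⟫_ℂ = ⟪w.fst, x.fst⟫_ℂ + ⟪M.K w.fst, x.snd⟫_ℂ := by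
    rw [hy₁, inner_add_right, ContinuousLinearMap.adjoint_inner_right]
  simp only [sub_apply, ContinuousLinearMap.comp_apply, starEmb_apply, T_apply, I_apply,
    diagShift_apply, innerSLFlip_apply_apply, WithLp.prod_inner_apply, inner_smul_right,
    inner_sub_right, WithLp.toLp_fst, WithLp.toLp_snd, WithLp.ofLp_fst, WithLp.ofLp_snd, h]
  ring

theorem mem_pmapSpectrum_angularExtension_iff (c : ℂ) :
    c ∈ pmapSpectrum M.angularExtension ↔ c ∈ pencilSpectrum M.pencil :=
  not_congr (M.rigging.mem_pmapResolventSet_bullet_iff M.T M.diagShift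
    M.T_sub_diagShift_surjective c)

end SemiboundedOperatorMatrix

theorem mainTheorem2 {H₁ H₂ : Type*} [NormedAddCommGroup H₁] [InnerProductSpace ℂ H₁]
    [CompleteSpace H₁] [NormedAddCommGroup H₂] [InnerProductSpace ℂ H₂] [CompleteSpace H₂]
    (M : SemiboundedOperatorMatrix H₁ H₂) :
    (∀ c : ℝ, (c : ℂ) ∈ pmapSpectrum M.angularExtension ↔ (c : ℂ) ∈ pencilSpectrum M.pencil) ∧
    (∀ c : ℝ, IsPMapEigenvalue M.angularExtension c →
      pmapMultiplicity M.angularExtension c =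
        Module.rank ℂ (LinearMap.ker (M.pencil c).toLinearMap)) :=
  ⟨fun c => M.mem_pmapSpectrum_angularExtension_iff c,
    fun c _ => M.rigging.rank_ker_eq_pmapMultiplicity_bullet M.T c⟩
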